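/- Let $G$ be a finitely generated (discrete) group and let $X$ be a Cantor space, that is, a metric space $(X,d)$ homeomorphic to $\{0,1\}^{\mathbb N}$. Let $G$ act on $X$ by homeomorphisms, and suppose the action is distal: $\inf_{g\in G} d(gx,gy)>0$ for all $x\neq y$ in $X$. Then the action has the pseudo-orbit tracing property (POTP): there is a finite generating set $A$ of $G$ (not necessarily symmetric) such that $(*)$ for every $\varepsilon>0$ there is $\delta>0$ such that for every family $(x_g)_{g\in G}$ of points of $X$ with $d(a x_g, x_{ag})<\delta$ for all $a\in A$ and $g\in G$, there is a point $p\in X$ with $d(gp,x_g)<\varepsilon$ for all $g\in G$. Moreover, $(*)$ holds for every finite generating set $A$ of $G$. -/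

import Mathlib

/-- An action of a group `G` on a metric space `X` is distal if distinct points have orbits that
stay at a positive distance: `inf_g d(gx, gy) > 0` whenever `x ≠ y`. -/
def IsDistalAction (G X : Type*) [Group G] [MetricSpace X] [MulAction G X] : Prop :=
  ∀ x y : X, x ≠ y → 0 < ⨅ g : G, dist (g • x) (g • y)

/-- `A` is a finite generating set of the group `G` (not necessarily symmetric). -/
def IsFiniteGeneratingSet {G : Type*} [Group G] (A : Set G) : Prop :=
  A.Finite ∧ Subgroup.closure A = ⊤

/-- A `δ` pseudo-orbit of an action with respect to `A`: a family `(x_g)` of points with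
`d(a x_g, x_{ag}) < δ` for all `a ∈ A` and `g ∈ G`. -/
def IsPseudoOrbit {G X : Type*} [Group G] [MetricSpace X] [MulAction G X]
    (A : Set G) (δ : ℝ) (x : G → X) : Prop :=
  ∀ a ∈ A, ∀ g : G, dist (a • x g) (x (a * g)) < δ

/-- The pseudo-orbit tracing property of an action with respect to `A`. -/
def HasPOTPWith {G : Type*} (X : Type*) [Group G] [MetricSpace X] [MulAction G X]
    (A : Set G) : Prop :=
  ∀ ε : ℝ, 0 < ε → ∃ δ : ℝ, 0 < δ ∧ ∀ x : G → X, IsPseudoOrbit A δ x →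
    ∃ p : X, ∀ g : G, dist (g • p) (x g) < ε

/-- The pseudo-orbit tracing property of an action of a finitely generated group: it holds with
respect to some finite generating set. -/
def HasPOTP (G X : Type*) [Group G] [MetricSpace X] [MulAction G X] : Prop :=
  ∃ A : Set G, IsFiniteGeneratingSet A ∧ HasPOTPWith X A

open Set Topology Pointwise

/-! A distal action on a Cantor space has arbitrarily fine invariant open equivalence relations. If
`δ` is so small that `δ`-close points are equivalent, induction on words keeps `x g` in the class of
`g • x 1`, so `x 1` traces. To get such a relation, take a fine clopen one and its largest invariant
subrelation. Distality makes the enveloping semigroup a group, hence orbit closures in `X × X` are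
symmetric; with compactness, finitely many translates then cut out the subrelation
(`isOpen_setOf_forall_smul_mem`), so it is open. -/

/-- If the orbit closure relation of a compact space is symmetric and the group is exhausted by the
powers of a finite symmetric set, then the largest invariant subset of a clopen set is open. -/
theorem isOpen_setOf_forall_smul_mem {G Y : Type*} [Group G] [TopologicalSpace Y] [CompactSpace Y]
    [MulAction G Y] [ContinuousConstSMul G Y] {S : Set G} (hfin : S.Finite) (hone : (1 : G) ∈ S)
    (hinv : S⁻¹ = S) (hgen : ∀ g : G, ∃ n : ℕ, g ∈ S ^ n)
    (hsymm : ∀ z w : Y, w ∈ closure (MulAction.orbit G z) → z ∈ closure (MulAction.orbit G w))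
    {U : Set Y} (hU : IsClopen U) : IsOpen {y : Y | ∀ g : G, g • y ∈ U} := by
  have hpow : ∀ n : ℕ, (S ^ n).Finite := fun n => by
    induction n with
    | zero => simp
    | succ n ih => rw [pow_succ]; exact ih.mul hfin
  have hmono : ∀ {m n : ℕ}, m ≤ n → S ^ m ⊆ S ^ n := fun h => pow_subset_pow_right hone h
  have hclosed : ∀ g : G, IsClosed {y : Y | g • y ∈ U} := fun g =>
    hU.isClosed.preimage (continuous_const_smul g)
  have hclosedBall : ∀ n : ℕ, IsClosed {y : Y | ∀ b ∈ S ^ n, b • y ∈ U} := fun n => by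
    simp only [ofPred_forall]
    exact isClosed_biInter fun b _ => hclosed b
  -- `D k` consists of the points whose orbit stays in `U` along some ball of radius `k`.
  let D : ℕ → Set Y := fun k => {z | ∃ h ∈ S ^ (k + 1), ∀ b ∈ S ^ k, b • h • z ∈ U}
  have hD : ∀ k, IsClosed (D k) := fun k => by
    have : D k = ⋃ h ∈ S ^ (k + 1), (fun z : Y => h • z) ⁻¹' {y | ∀ b ∈ S ^ k, b • y ∈ U} := by
      ext z; simp [D]
    rw [this]
    exact (hpow _).isClosed_biUnion fun h _ => (hclosedBall k).preimage (continuous_const_smul h)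
  -- Otherwise the orbit closure of some `z ∉ U` contains a `w` whose whole orbit lies in `U`; by
  -- symmetry `z` is in the closure of that orbit, hence in `U`.
  have hempty : ¬ (Uᶜ ∩ ⋂ k, D k).Nonempty := by
    rintro ⟨z, hzU, hz⟩
    rw [mem_iInter] at hz
    obtain ⟨w, hw⟩ := IsCompact.nonempty_iInter_of_sequence_nonempty_isCompact_isClosed
      (fun k => closure (MulAction.orbit G z) ∩ {y : Y | ∀ b ∈ S ^ k, b • y ∈ U})
      (fun k y hy => ⟨hy.1, fun b hb => hy.2 b (hmono k.le_succ hb)⟩)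
      (fun k => by
        obtain ⟨h, -, hb⟩ := hz k
        exact ⟨h • z, subset_closure (MulAction.mem_orbit z h), hb⟩)
      (isClosed_closure.inter (hclosedBall 0)).isCompact
      (fun k => isClosed_closure.inter (hclosedBall k))
    rw [mem_iInter] at hw
    refine hzU (closure_minimal ?_ hU.isClosed (hsymm z w (hw 0).1))
    rintro _ ⟨g, rfl⟩
    obtain ⟨n, hn⟩ := hgen g
    exact (hw n).2 g hn
  obtain ⟨u, hu⟩ : ∃ u : Finset ℕ, ¬ (Uᶜ ∩ ⋂ k ∈ u, D k).Nonempty := by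
    by_contra! h
    exact hempty (hU.compl.isClosed.isCompact.inter_iInter_nonempty D hD h)
  let N := u.sup id
  have heq : {y : Y | ∀ g : G, g • y ∈ U} = ⋂ b ∈ S ^ N, {y : Y | b • y ∈ U} := by
    refine Subset.antisymm (fun y hy => mem_iInter₂.2 fun b _ => hy b) fun y hy => ?_
    rw [mem_iInter₂] at hy
    by_contra hne
    have hex : ∃ n : ℕ, ∃ g ∈ S ^ n, g • y ∉ U := by
      simp only [mem_ofPred_eq, not_forall] at hne
      obtain ⟨g, hg⟩ := hne
      obtain ⟨n, hn⟩ := hgen g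
      exact ⟨n, g, hn, hg⟩
    classical
    obtain ⟨n, ⟨g, hg, hgU⟩, hmin⟩ : ∃ n : ℕ, (∃ g ∈ S ^ n, g • y ∉ U) ∧
        ∀ m < n, ∀ g ∈ S ^ m, g • y ∈ U := by
      refine ⟨Nat.find hex, Nat.find_spec hex, fun m hm g hg => ?_⟩
      by_contra hgU
      exact Nat.find_min hex hm ⟨g, hg, hgU⟩
    have hNn : N < n := by
      by_contra! h
      exact hgU (hy g (hmono h hg))
    -- A shortest exit word `g = s * t` with `s ∈ S ^ (k + 1)`: `s⁻¹` leads back to `t • y`, whose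
    -- `S ^ k`-translates use words shorter than `n` and so stay in `U`.
    refine hu ⟨g • y, hgU, mem_iInter₂.2 fun k hk => ?_⟩
    have hkn : k < n := (Finset.le_sup (f := id) hk).trans_lt hNn
    obtain ⟨m, rfl⟩ : ∃ m, n = (k + 1) + m := ⟨n - (k + 1), by omega⟩
    rw [pow_add] at hg
    obtain ⟨s, hs, t, ht, rfl⟩ := hg
    refine ⟨s⁻¹, ?_, fun b hb => ?_⟩
    · rw [← hinv, inv_pow]
      exact Set.inv_mem_inv.2 hs
    · have : b • s⁻¹ • (s * t) • y = (b * t) • y := by simp only [smul_smul]; group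
      change b • s⁻¹ • (s * t) • y ∈ U
      rw [this]
      refine hmin (k + m) (by omega) _ ?_
      rw [pow_add]
      exact mul_mem_mul hb ht
  rw [heq]
  exact (hpow N).isOpen_biInter fun b _ => hU.isOpen.preimage (continuous_const_smul b)

/-- The enveloping (Ellis) semigroup of an action: the pointwise closure of the translations. -/
def envelopingSemigroup (G X : Type*) [Group G] [TopologicalSpace X] [MulAction G X] :
    Set (X → X) :=
  closure (range fun (g : G) (x : X) => g • x)

section EnvelopingSemigroup

variable {G X : Type*} [Group G]

theorem isClosed_envelopingSemigroup [TopologicalSpace X] [MulAction G X] :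
    IsClosed (envelopingSemigroup G X) :=
  isClosed_closure

theorem comp_mem_envelopingSemigroup [TopologicalSpace X] [MulAction G X]
    [ContinuousConstSMul G X] {p q : X → X} (hp : p ∈ envelopingSemigroup G X)
    (hq : q ∈ envelopingSemigroup G X) : p ∘ q ∈ envelopingSemigroup G X := by
  have hsmul : ∀ g : G, (fun x => g • q x) ∈ envelopingSemigroup G X := fun g => by
    refine map_mem_closure (f := fun (r : X → X) (x : X) => g • r x)
      (continuous_pi fun x => (continuous_apply x).const_smul g) hq ?_
    rintro _ ⟨h, rfl⟩
    exact ⟨g * h, funext fun x => mul_smul g h x⟩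
  have hcont : Continuous fun r : X → X => r ∘ q :=
    continuous_pi fun x => continuous_apply (q x)
  have h := map_mem_closure (t := envelopingSemigroup G X) hcont hp (by
    rintro _ ⟨g, rfl⟩
    exact hsmul g)
  rwa [isClosed_envelopingSemigroup.closure_eq] at h

/-- The only idempotent of the enveloping semigroup of a distal action is the identity. -/
theorem IsDistalAction.eq_id_of_idempotent [MetricSpace X] [MulAction G X]
    (hd : IsDistalAction G X) {u : X → X} (hu : u ∈ envelopingSemigroup G X)
    (hidem : u ∘ u = u) : u = id := by
  funext x
  by_contra hne
  have hpos := hd (u x) x hne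
  have hopen : IsOpen {r : X → X | dist (r (u x)) (r x) < ⨅ g : G, dist (g • u x) (g • x)} :=
    isOpen_lt ((continuous_apply _).dist (continuous_apply _)) continuous_const
  -- `u` identifies `u x` with `x`, so a translation near `u` brings them closer than the infimum.
  obtain ⟨_, hr, g, rfl⟩ := mem_closure_iff.1 hu _ hopen (by
    have : u (u x) = u x := congrFun hidem x
    simpa [this] using hpos)
  have hbdd : BddBelow (range fun g : G => dist (g • u x) (g • x)) :=
    ⟨0, by rintro _ ⟨g, rfl⟩; exact dist_nonneg⟩
  exact (ciInf_le hbdd g).not_gt hr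

/-- The left ideal generated by `p` is a compact semigroup with continuous right multiplications, so
it contains an idempotent `q ∘ p`, which distality forces to be `id`. -/
theorem IsDistalAction.exists_leftInverse [MetricSpace X] [CompactSpace X] [MulAction G X]
    [ContinuousConstSMul G X] (hd : IsDistalAction G X) {p : X → X}
    (hp : p ∈ envelopingSemigroup G X) : ∃ q ∈ envelopingSemigroup G X, q ∘ p = id := by
  let _ : Semigroup (X → X) := { mul := fun a b => a ∘ b, mul_assoc := fun _ _ _ => rfl }
  have hcont : ∀ r : X → X, Continuous fun s : X → X => s * r := fun r =>
    continuous_pi fun x => continuous_apply (r x)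
  obtain ⟨_, ⟨q, hq, rfl⟩, hidem⟩ := exists_idempotent_in_compact_subsemigroup hcont
    ((fun s : X → X => s * p) '' envelopingSemigroup G X)
    (image_nonempty.2 ⟨p, hp⟩)
    (isClosed_envelopingSemigroup.isCompact.image (hcont p))
    (by
      rintro _ ⟨a, ha, rfl⟩ _ ⟨b, hb, rfl⟩
      exact ⟨a * p * b, comp_mem_envelopingSemigroup (comp_mem_envelopingSemigroup ha hp) hb, rfl⟩)
  exact ⟨q, hq, hd.eq_id_of_idempotent (comp_mem_envelopingSemigroup hq hp) hidem⟩

/-- For a distal action on a compact space, the orbit closure relation on pairs is symmetric. -/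
theorem IsDistalAction.mem_closure_orbit_prod_symm [MetricSpace X] [CompactSpace X]
    [MulAction G X] [ContinuousConstSMul G X] (hd : IsDistalAction G X) (z w : X × X)
    (hw : w ∈ closure (MulAction.orbit G z)) : z ∈ closure (MulAction.orbit G w) := by
  have hcont : ∀ v : X × X, Continuous fun r : X → X => (r v.1, r v.2) := fun v =>
    (continuous_apply _).prodMk (continuous_apply _)
  obtain ⟨p, hp, rfl⟩ : w ∈ (fun r : X → X => (r z.1, r z.2)) '' envelopingSemigroup G X := by
    refine closure_minimal ?_
      (isClosed_envelopingSemigroup.isCompact.image (hcont z)).isClosed hw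
    rintro _ ⟨g, rfl⟩
    exact ⟨fun x => g • x, subset_closure ⟨g, rfl⟩, rfl⟩
  obtain ⟨q, hq, hqp⟩ := hd.exists_leftInverse hp
  have h := map_mem_closure (t := MulAction.orbit G (p z.1, p z.2)) (hcont (p z.1, p z.2)) hq (by
    rintro _ ⟨g, rfl⟩
    exact ⟨g, rfl⟩)
  have h1 : q (p z.1) = z.1 := congrFun hqp z.1
  have h2 : q (p z.2) = z.2 := congrFun hqp z.2
  simpa only [h1, h2] using h

end EnvelopingSemigroup

/-- A finite generating set lies in a finite symmetric set whose powers exhaust the group. -/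
theorem IsFiniteGeneratingSet.exists_symmetric {G : Type*} [Group G] {A : Set G}
    (hA : IsFiniteGeneratingSet A) :
    ∃ S : Set G, S.Finite ∧ (1 : G) ∈ S ∧ S⁻¹ = S ∧ ∀ g : G, ∃ n : ℕ, g ∈ S ^ n := by
  refine ⟨{1} ∪ (A ∪ A⁻¹), (finite_singleton 1).union (hA.1.union hA.1.inv), by simp, ?_,
    fun g => ?_⟩
  · simp [union_comm]
  · have hg : g ∈ Subgroup.closure A := by rw [hA.2]; trivial
    induction hg using Subgroup.closure_induction_left with
    | one => exact ⟨0, by simp⟩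
    | mul_left a ha y _ ih =>
      obtain ⟨n, hn⟩ := ih
      exact ⟨n + 1, by rw [pow_succ']; exact mul_mem_mul (by simp [ha]) hn⟩
    | inv_mul_cancel a ha y _ ih =>
      obtain ⟨n, hn⟩ := ih
      exact ⟨n + 1, by rw [pow_succ']; exact mul_mem_mul (by simp [ha]) hn⟩

/-- A Cantor space has arbitrarily fine clopen equivalence relations. -/
theorem exists_clopen_setoid_dist_lt {X : Type*} [MetricSpace X] [CompactSpace X]
    (f : X ≃ₜ (ℕ → Bool)) {ε : ℝ} (hε : 0 < ε) :
    ∃ r : Setoid X, IsClopen {p : X × X | r p.1 p.2} ∧ ∀ x y, r x y → dist x y < ε := by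
  let V : ℕ → Set (X × X) := fun n => {p | ∀ i < n, f p.1 i = f p.2 i}
  have hV : ∀ n, IsClopen (V n) := fun n => by
    have : V n = ⋂ i ∈ Iio n, {p : X × X | f p.1 i = f p.2 i} := by ext p; simp [V]
    rw [this]
    refine (finite_Iio n).isClopen_biInter fun i _ => ?_
    have hc : Continuous fun p : X × X => (f p.1 i, f p.2 i) := by fun_prop
    exact (isClopen_discrete {b : Bool × Bool | b.1 = b.2}).preimage hc
  -- The compact sets `V n` decrease to the diagonal.
  obtain ⟨n, hn⟩ := exists_subset_nhds_of_isCompact' (V := V)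
    (U := {p : X × X | dist p.1 p.2 < ε})
    (directed_of_isDirected_le fun m n hmn p hp i hi => hp i (hi.trans_le hmn))
    (fun n => (hV n).isClosed.isCompact) (fun n => (hV n).isClosed) (fun p hp => by
      have hp' : p.1 = p.2 := f.injective (funext fun i => mem_iInter.1 hp (i + 1) i i.lt_succ_self)
      refine (isOpen_lt (by fun_prop) continuous_const).mem_nhds ?_
      simpa [hp'] using hε)
  refine ⟨⟨fun x y => (x, y) ∈ V n, fun x i _ => rfl, fun h i hi => (h i hi).symm,
    fun h h' i hi => (h i hi).trans (h' i hi)⟩, hV n, fun x y h => hn h⟩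

/-- A distal action of a finitely generated group on a Cantor space has arbitrarily fine invariant
open equivalence relations. -/
theorem IsDistalAction.exists_invariant_setoid {G X : Type*} [Group G] [MetricSpace X]
    [CompactSpace X] [MulAction G X] [ContinuousConstSMul G X] (hd : IsDistalAction G X)
    {A : Set G} (hA : IsFiniteGeneratingSet A) (f : X ≃ₜ (ℕ → Bool)) {ε : ℝ} (hε : 0 < ε) :
    ∃ r : Setoid X, IsOpen {p : X × X | r p.1 p.2} ∧
      (∀ (g : G) (x y : X), r x y → r (g • x) (g • y)) ∧ ∀ x y, r x y → dist x y < ε := by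
  obtain ⟨S, hfin, hone, hinv, hgen⟩ := hA.exists_symmetric
  obtain ⟨r, hr, hrε⟩ := exists_clopen_setoid_dist_lt f hε
  refine ⟨⟨fun x y => ∀ g : G, r (g • x) (g • y), fun x g => r.refl _, fun h g => r.symm (h g),
    fun h h' g => r.trans (h g) (h' g)⟩,
    isOpen_setOf_forall_smul_mem hfin hone hinv hgen hd.mem_closure_orbit_prod_symm hr,
    fun g x y h k => ?_, fun x y h => hrε x y (by simpa using h 1)⟩
  simpa only [smul_smul] using h (k * g)

/-- Pseudo-orbits of a distal action on a Cantor space are traced by their value at `1`. -/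
theorem IsDistalAction.hasPOTPWith {G X : Type*} [Group G] [MetricSpace X]
    [CompactSpace X] [MulAction G X] [ContinuousConstSMul G X] (hd : IsDistalAction G X)
    {A : Set G} (hA : IsFiniteGeneratingSet A) (f : X ≃ₜ (ℕ → Bool)) : HasPOTPWith X A := by
  intro ε hε
  obtain ⟨r, hopen, hsmul, hrε⟩ := hd.exists_invariant_setoid hA f hε
  have hnhds : {p : X × X | r p.1 p.2} ∈ uniformity X := by
    rw [← nhdsSet_diagonal_eq_uniformity, hopen.mem_nhdsSet]
    rintro ⟨x, y⟩ (rfl : x = y)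
    exact r.refl x
  obtain ⟨δ, hδ, hδr⟩ := Metric.mem_uniformity_dist.1 hnhds
  refine ⟨δ, hδ, fun x hx => ⟨x 1, fun g => hrε _ _ ?_⟩⟩
  have hstep : ∀ a ∈ A, ∀ g : G, r (a • x g) (x (a * g)) := fun a ha g => hδr (hx a ha g)
  have hg : g ∈ Subgroup.closure A := by rw [hA.2]; trivial
  induction hg using Subgroup.closure_induction_left with
  | one => rw [one_smul]
  | mul_left a ha y _ ih =>
    rw [mul_smul]
    exact r.trans (hsmul a _ _ ih) (hstep a ha y)
  | inv_mul_cancel a ha y _ ih =>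
    -- Invariance under `a⁻¹` reverses a step, so `A` need not be symmetric.
    have h := hsmul a⁻¹ _ _ (hstep a ha (a⁻¹ * y))
    rw [inv_smul_smul, mul_inv_cancel_left] at h
    rw [mul_smul]
    exact r.trans (hsmul a⁻¹ _ _ ih) (r.symm h)

theorem mainTheorem5 {G X : Type*} [Group G] [Group.FG G] [MetricSpace X]
    [MulAction G X] [ContinuousConstSMul G X]
    (hX : Nonempty (X ≃ₜ (ℕ → Bool))) (hdistal : IsDistalAction G X) :
    HasPOTP G X ∧ ∀ A : Set G, IsFiniteGeneratingSet A → HasPOTPWith X A := by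
  obtain ⟨f⟩ := hX
  have : CompactSpace X := f.symm.compactSpace
  obtain ⟨A, hA, hfin⟩ := Group.fg_iff.1 (inferInstance : Group.FG G)
  exact ⟨⟨A, ⟨hfin, hA⟩, hdistal.hasPOTPWith ⟨hfin, hA⟩ f⟩,
    fun B hB => hdistal.hasPOTPWith hB f⟩
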